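/- **Conventions.** All spaces are compact Hausdorff. A *cover* of $X$ is a pair $(Z,f)$ with $f:Z\to X$ a continuous surjection such that $f(F)\ne X$ for every proper closed $F\subsetneq Z$. A *covering operator* $c$ assigns to each $X$ a cover $(cX,c_X)$ of $X$ which is the minimum among those covers $(Z,f)$ of $X$ for which $c_Z$ is a homeomorphism (where $(Z_1,f_1)\le (Z_2,f_2)$ if $f_2=f_1\circ g$ for some continuous $g:Z_2\to Z_1$). $\mathbf W^*$ is the category of Archimedean real vector lattices with a distinguished strong unit and unit-preserving vector lattice homomorphisms. A $\mathbf W^*$-embedding (injective morphism) $f:A\to B$ is *essential* if every $\mathbf W^*$-morphism $g:B\to D$ with $g\circ f$ injective is injective. $C(X)$ is the vector lattice of continuous real functions on $X$ with unit $1$, and $F(X)=\{f\in C(X): f(X)\text{ is finite}\}$. For $A\in\mathbf W^*$, $YA$ is the Yosida space of $A$ (the compact space of unit-preserving vector lattice homomorphisms $A\to\mathbb R$ with the topology of pointwise convergence; equivalently, of ideals maximal with respect to not containing the unit) and $\nu_A:A\to C(YA)$ is the Yosida embedding. For a covering operator $c$, $\mu(c)A=C(cYA)$, and $\mu(c)_A:A\to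 C(cYA)$ is $a\mapsto \nu_A(a)\circ c_{YA}$. As usual, $YA$ is regarded as given only up to homeomorphism, so that any space $X$ with a homeomorphism $\eta:X\to YA$ may be used in its place (then $\mu(c)A = C(cX)$ and $\mu(c)_A(a)=\nu_A(a)\circ\eta\circ c_X$). For a space $K$, $\mathcal V(C(K),\mu(c))$ is the collection of all $A\in\mathbf W^*$ with $\mu(c)A=C(K)$, each identified with the pair $(A,\mu(c)_A)$, where $\mu(c)_A:A\to C(K)$; that is, it consists of the pairs $(A,\varphi)$, where $cX=K$ and $\varphi(a)=\nu_A(a)\circ\eta\circ c_X$ for some space $X$ and some homeomorphism $\eta:X\to YA$. It is (pre)ordered by: $(A_1,\varphi_1)\le(A_2,\varphi_2)$ if there is an essential $\mathbf W^*$-embedding $f:A_1\to A_2$ with $\varphi_1=\varphi_2\circ f$. Let $E$ be an infinite extremally disconnected compact Hausdorff space and let $p\neq q$ be non-isolated points of $E$. Let $\gamma:E\to \dot E_\gamma$ be the quotient map that identifies just $p$ and $q$ (so $\dot E_\gamma$ is the one-point compactification of $E_\gamma=\dot E_\gamma\setminus\{\gamma(p)\}$). The covering operator $a(\gamma)$ (an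 atom of the lattice of covering operators, associated with $E$) is given by $$(a(\gamma)X,a(\gamma)_X)=\begin{cases}(E,\theta_X\circ\gamma)&\text{if }X\text{ is homeomorphic to }\dot E_\gamma,\\(X,\mathrm{id}_X)&\text{otherwise,}\end{cases}$$ where $\theta_X:\dot E_\gamma\to X$ is any chosen homeomorphism. **Theorem.** (i) $\mathcal V(C(E),\mu(a(\gamma)))$ has a minimum, namely $F(\dot E_\gamma)$ (with the embedding $f\mapsto f\circ\gamma$ into $C(E)$). (ii) If $Y$ is a compact Hausdorff space homeomorphic neither to $\dot E_\gamma$ nor to $E$, then $\mathcal V(C(Y),\mu(a(\gamma)))$ has a minimum if and only if $Y$ is zero-dimensional (its clopen sets form a base), and in that case the minimum is $F(Y)$ (with the inclusion into $C(Y)$). -/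

import Mathlib

open Set Topology

universe u

noncomputable section

/-! ### Covers and covering operators on compact Hausdorff spaces -/

/-- `f : Y → X` is a covering map: an irreducible continuous surjection.
(Between compact Hausdorff spaces every continuous map is perfect.) -/
def IsCover {Y X : Type u} [TopologicalSpace Y] [TopologicalSpace X] (f : C(Y, X)) : Prop :=
  Function.Surjective f ∧ ∀ F : Set Y, IsClosed F → F ≠ univ → f '' F ≠ univ

/-- A covering operator: it assigns to each compact Hausdorff space `X` a cover `(cX, c_X)` of `X`,
which is the minimum among the covers `(Z, f)` of `X` for which `c_Z` is a homeomorphism. -/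
structure CoveringOperator : Type (u + 1) where
  /-- the pair `(cX, c_X)` -/
  cover : ∀ X : CompHaus.{u}, Σ Z : CompHaus.{u}, C(Z, X)
  isCover : ∀ X, IsCover (cover X).2
  fixed : ∀ X, IsHomeomorph (cover (cover X).1).2
  minimum : ∀ (X Z : CompHaus.{u}) (f : C(Z, X)), IsCover f → IsHomeomorph (cover Z).2 →
    ∃ g : C(Z, (cover X).1), f = (cover X).2.comp g

/-! ### The atoms `a(γ)` -/

/-- The equivalence relation on `E` that identifies just `p` and `q`. -/
def identify (E : Type u) (p q : E) : Setoid E where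
  r x y := x = y ∨ ((x = p ∨ x = q) ∧ (y = p ∨ y = q))
  iseqv := by
    refine ⟨fun x => Or.inl rfl, ?_, ?_⟩
    · rintro x y (h | ⟨h, k⟩)
      · exact Or.inl h.symm
      · exact Or.inr ⟨k, h⟩
    · rintro x y z (rfl | ⟨h, k⟩) (rfl | ⟨h', k'⟩)
      · exact Or.inl rfl
      · exact Or.inr ⟨h', k'⟩
      · exact Or.inr ⟨h, k⟩
      · exact Or.inr ⟨h, k'⟩

theorem identify_iff {E : Type u} {p q x y : E} :
    Quotient.mk (identify E p q) x = Quotient.mk (identify E p q) y ↔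
      (x = y ∨ ((x = p ∨ x = q) ∧ (y = p ∨ y = q))) :=
  Quotient.eq

theorem isClosed_fibre {E : Type u} [TopologicalSpace E] [T2Space E] (p q a : E) :
    IsClosed {x | Quotient.mk (identify E p q) x = Quotient.mk (identify E p q) a} := by
  by_cases ha : a = p ∨ a = q
  · have : {x | Quotient.mk (identify E p q) x = Quotient.mk (identify E p q) a} = {p, q} := by
      ext x
      simp only [mem_ofPred_eq, identify_iff, mem_insert_iff, mem_singleton_iff]
      constructor
      · rintro (rfl | ⟨h, -⟩)
        · exact ha
        · exact h
      · exact fun h => Or.inr ⟨h, ha⟩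
    rw [this]
    exact (Set.toFinite _).isClosed
  · have : {x | Quotient.mk (identify E p q) x = Quotient.mk (identify E p q) a} = {a} := by
      ext x
      simp only [mem_ofPred_eq, identify_iff, mem_singleton_iff]
      constructor
      · rintro (rfl | ⟨-, h⟩)
        · rfl
        · exact absurd h ha
      · exact fun h => Or.inl h
    rw [this]
    exact isClosed_singleton

instance identify_t2 (E : Type u) [TopologicalSpace E] [CompactSpace E] [T2Space E] (p q : E) :
    T2Space (Quotient (identify E p q)) := by
  refine ⟨fun a b => ?_⟩
  refine Quotient.inductionOn₂ a b fun a b hab => ?_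
  have key : ∃ f : C(E, ℝ), f a = 0 ∧ f b = 1 ∧ f p = f q := by
    have hne : ¬ (a = b ∨ ((a = p ∨ a = q) ∧ (b = p ∨ b = q))) := fun h => hab (identify_iff.2 h)
    push Not at hne
    by_cases ha : a = p ∨ a = q
    · have hb := hne.2 ha
      obtain ⟨f, hf0, hf1, -⟩ := exists_continuous_zero_one_of_isClosed
        (s := {p, q}) (t := {b}) (Set.toFinite _).isClosed isClosed_singleton
        (by
          rw [Set.disjoint_singleton_right]
          rintro (h | h)
          · exact hb.1 h
          · exact hb.2 h)
      refine ⟨f, ?_, hf1 rfl, ?_⟩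
      · rcases ha with rfl | rfl
        · exact hf0 (by simp)
        · exact hf0 (by simp)
      · exact (hf0 (show p ∈ ({p, q} : Set E) by simp)).trans
          (hf0 (show q ∈ ({p, q} : Set E) by simp)).symm
    · push Not at ha
      obtain ⟨f, hf0, hf1, -⟩ := exists_continuous_zero_one_of_isClosed
        (s := {a}) (t := {p, q, b}) isClosed_singleton (Set.toFinite _).isClosed
        (by
          rw [Set.disjoint_singleton_left]
          rintro (h | h | h)
          · exact ha.1 h
          · exact ha.2 h
          · exact hne.1 h)
      refine ⟨f, hf0 rfl, hf1 (by simp), ?_⟩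
      exact (hf1 (show p ∈ ({p, q, b} : Set E) by simp)).trans
        (hf1 (show q ∈ ({p, q, b} : Set E) by simp)).symm
  obtain ⟨f, hfa, hfb, hf⟩ := key
  let F : Quotient (identify E p q) → ℝ := Quotient.lift f (by
    rintro x y (rfl | ⟨rfl | rfl, rfl | rfl⟩)
    · rfl
    · rfl
    · exact hf
    · exact hf.symm
    · rfl)
  have hF : Continuous F := f.continuous.quotient_lift _
  refine separated_by_continuous hF ?_
  change f a ≠ f b
  rw [hfa, hfb]
  exact zero_ne_one

/-- The quotient `E_pq` of `E` that identifies just `p` and `q`; it is the one-point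
compactification of the complement of the identified point. -/
def glued (E : CompHaus.{u}) (p q : E) : CompHaus.{u} := CompHaus.of (Quotient (identify E p q))

/-- The quotient map `γ : E → E_pq`. -/
def gluing (E : CompHaus.{u}) (p q : E) : C(E, glued E p q) :=
  ⟨fun x => Quotient.mk (identify E p q) x, continuous_quotient_mk'⟩

theorem gluing_eq_iff {E : CompHaus.{u}} {p q x y : E} :
    gluing E p q x = gluing E p q y ↔ (x = y ∨ ((x = p ∨ x = q) ∧ (y = p ∨ y = q))) :=
  identify_iff

theorem isCover_gluing (E : CompHaus.{u}) (p q : E) (hpq : p ≠ q) (hp : ¬ IsOpen ({p} : Set E))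
    (hq : ¬ IsOpen ({q} : Set E)) : IsCover (gluing E p q) := by
  refine ⟨fun y => Quotient.inductionOn y fun x => ⟨x, rfl⟩, fun F hF hne himg => ?_⟩
  have hsub : Fᶜ ⊆ {p, q} := by
    intro x hx
    obtain ⟨y, hy, hyx⟩ : gluing E p q x ∈ gluing E p q '' F := by rw [himg]; trivial
    rcases gluing_eq_iff.1 hyx with rfl | ⟨-, h⟩
    · exact absurd hy hx
    · exact h
  obtain ⟨x, hx⟩ : Fᶜ.Nonempty := by
    rw [Set.nonempty_compl]; exact hne
  have : T1Space E := T2Space.t1Space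
  have hopen : ∀ z : E, IsOpen (Fᶜ ∩ {z}ᶜ) := fun z =>
    hF.isOpen_compl.inter isOpen_compl_singleton
  rcases hsub hx with rfl | hxq
  · apply hp
    have : ({x} : Set E) = Fᶜ ∩ {q}ᶜ := by
      ext z
      constructor
      · rintro rfl
        exact ⟨hx, hpq⟩
      · rintro ⟨h1, h2⟩
        rcases hsub h1 with h | h
        · exact h
        · exact absurd h h2
    rw [this]
    exact hopen q
  · have hxq' : x = q := hxq
    subst hxq'
    apply hq
    have : ({x} : Set E) = Fᶜ ∩ {p}ᶜ := by
      ext z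
      constructor
      · rintro rfl
        exact ⟨hx, fun h => hpq h.symm⟩
      · rintro ⟨h1, h2⟩
        rcases hsub h1 with h | h
        · exact absurd h h2
        · exact h
    rw [this]
    exact hopen p

theorem isCover_id (X : CompHaus.{u}) : IsCover (ContinuousMap.id X) :=
  ⟨fun x => ⟨x, rfl⟩, fun F _ hne => by simpa using hne⟩

theorem IsCover.homeo_comp {X Y Z : CompHaus.{u}} {f : C(X, Y)} (hf : IsCover f) (e : Y ≃ₜ Z) :
    IsCover ((e : C(Y, Z)).comp f) := by
  refine ⟨e.surjective.comp hf.1, fun F hF hne h => hf.2 F hF hne ?_⟩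
  have h' : e '' (f '' F) = univ := by
    rw [← Set.image_comp]
    exact h
  rw [Set.eq_univ_iff_forall]
  intro y
  obtain ⟨y', hy', h2⟩ : e y ∈ e '' (f '' F) := by rw [h']; trivial
  rwa [e.injective h2] at hy'

/-- A continuous map into the domain of a cover is onto when its composite with the cover is. -/
theorem IsCover.surjective_of_comp {X Y Z : CompHaus.{u}} {f : C(X, Y)} (hf : IsCover f)
    (g : C(Z, X)) (h : Function.Surjective (f.comp g)) : Function.Surjective g := by
  by_contra hg
  refine hf.2 (range g) (isCompact_range g.continuous).isClosed
    (fun hr => hg (Set.range_eq_univ.1 hr)) ?_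
  rw [← Set.range_comp]
  exact Set.range_eq_univ.2 h

/-- An extremally disconnected space is the domain of any of its covers, up to homeomorphism. -/
theorem IsCover.isHomeomorph {X E : CompHaus.{u}} [ExtremallyDisconnected E] {f : C(X, E)}
    (hf : IsCover f) : IsHomeomorph f := by
  obtain ⟨s, hs, hfs⟩ := (CompactT2.ExtremallyDisconnected.projective (A := E))
    (continuous_id) f.continuous hf.1
  have hsur : Function.Surjective s :=
    hf.surjective_of_comp ⟨s, hs⟩ (fun e => ⟨e, congrFun hfs e⟩)
  refine (isHomeomorph_iff_continuous_bijective).2 ⟨f.continuous, ?_, hf.1⟩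
  intro x y hxy
  obtain ⟨a, rfl⟩ := hsur x
  obtain ⟨b, rfl⟩ := hsur y
  have ha : f (s a) = a := congrFun hfs a
  have hb : f (s b) = b := congrFun hfs b
  rw [ha, hb] at hxy
  rw [hxy]

theorem not_homeomorph_glued (E : CompHaus.{u}) [ExtremallyDisconnected E] (p q : E)
    (hpq : p ≠ q) (hp : ¬ IsOpen ({p} : Set E)) (hq : ¬ IsOpen ({q} : Set E)) :
    ¬ Nonempty (glued E p q ≃ₜ E) := by
  rintro ⟨e⟩
  have h := ((isCover_gluing E p q hpq hp hq).homeo_comp e).isHomeomorph.injective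
  exact hpq (h (congrArg e (gluing_eq_iff.2 (Or.inr ⟨Or.inl rfl, Or.inr rfl⟩))))

open Classical in
/-- The pair `(a(γ)X, a(γ)_X)`: it is `(E, θ_X ∘ γ)` if `X` is homeomorphic to `E_pq`, where
`θ_X : E_pq → X` is a homeomorphism, and `(X, id)` otherwise. -/
def atomCover (E : CompHaus.{u}) (p q : E)
    (θ : ∀ X : CompHaus.{u}, Nonempty (glued E p q ≃ₜ X) → (glued E p q ≃ₜ X))
    (X : CompHaus.{u}) : Σ Z : CompHaus.{u}, C(Z, X) :=
  if h : Nonempty (glued E p q ≃ₜ X) then ⟨E, (θ X h : C(glued E p q, X)).comp (gluing E p q)⟩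
  else ⟨X, ContinuousMap.id X⟩

/-- The covering operator `a(γ)`, where `γ` identifies just the two distinct non-isolated points
`p`, `q` of the extremally disconnected space `E`. -/
def atomOperator (E : CompHaus.{u}) [ExtremallyDisconnected E] (p q : E)
    (hpq : p ≠ q) (hp : ¬ IsOpen ({p} : Set E)) (hq : ¬ IsOpen ({q} : Set E))
    (θ : ∀ X : CompHaus.{u}, Nonempty (glued E p q ≃ₜ X) → (glued E p q ≃ₜ X)) :
    CoveringOperator.{u} where
  cover := atomCover E p q θ
  isCover X := by
    by_cases h : Nonempty (glued E p q ≃ₜ X)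
    · rw [atomCover, dif_pos h]
      exact (isCover_gluing E p q hpq hp hq).homeo_comp _
    · rw [atomCover, dif_neg h]
      exact isCover_id X
  fixed X := by
    have hid : ∀ Z : CompHaus.{u}, ¬ Nonempty (glued E p q ≃ₜ Z) →
        IsHomeomorph (atomCover E p q θ Z).2 := by
      intro Z hZ
      rw [atomCover, dif_neg hZ]
      exact IsHomeomorph.id
    apply hid
    by_cases h : Nonempty (glued E p q ≃ₜ X)
    · rw [atomCover, dif_pos h]
      exact not_homeomorph_glued E p q hpq hp hq
    · rw [atomCover, dif_neg h]
      exact h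
  minimum X Z f hf hZ := by
    have hZ' : ¬ Nonempty (glued E p q ≃ₜ Z) := by
      intro h
      rw [atomCover, dif_pos h] at hZ
      exact hpq (hZ.injective (congrArg (θ Z h)
        (gluing_eq_iff.2 (Or.inr ⟨Or.inl rfl, Or.inr rfl⟩))))
    by_cases h : Nonempty (glued E p q ≃ₜ X)
    · rw [atomCover, dif_pos h]
      have hcov := (isCover_gluing E p q hpq hp hq).homeo_comp (θ X h)
      obtain ⟨s, hs, hfs⟩ := (CompactT2.ExtremallyDisconnected.projective (A := E))
        ((θ X h : C(glued E p q, X)).comp (gluing E p q)).continuous f.continuous hf.1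
      have hsur : Function.Surjective s := by
        refine hf.surjective_of_comp ⟨s, hs⟩ ?_
        intro x
        obtain ⟨e, he⟩ := hcov.1 x
        exact ⟨e, (congrFun hfs e).trans he⟩
      have hker : ∀ x y, s x = s y → gluing E p q x = gluing E p q y := by
        intro x y hxy
        have h1 := congrFun hfs x
        have h2 := congrFun hfs y
        simp only [Function.comp_apply, hxy] at h1 h2
        exact (θ X h).injective (h1.symm.trans h2)
      have hinj : Function.Injective s := by
        by_contra hni
        apply hZ'
        have hspq : s p = s q := by
          simp only [Function.Injective, not_forall] at hni
          obtain ⟨x, y, hxy, hne⟩ := hni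
          rcases gluing_eq_iff.1 (hker x y hxy) with h0 | ⟨rfl | rfl, rfl | rfl⟩
          · exact absurd h0 hne
          · exact absurd rfl hne
          · exact hxy
          · exact hxy.symm
          · exact absurd rfl hne
        let S : glued E p q → Z := Quotient.lift (s := identify E p q) s (by
          rintro x y (rfl | ⟨rfl | rfl, rfl | rfl⟩)
          · rfl
          · rfl
          · exact hspq
          · exact hspq.symm
          · rfl)
        have hScont : Continuous S := hs.quotient_lift _
        have hSbij : Function.Bijective S := by
          constructor
          · intro a b
            refine Quotient.inductionOn₂ a b fun a b hab => ?_
            exact hker a b hab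
          · intro z
            obtain ⟨e, he⟩ := hsur z
            exact ⟨gluing E p q e, he⟩
        exact ⟨((isHomeomorph_iff_continuous_bijective).2 ⟨hScont, hSbij⟩).homeomorph⟩
      let e := ((isHomeomorph_iff_continuous_bijective).2 ⟨hs, hinj, hsur⟩).homeomorph
      refine ⟨(e.symm : C(Z, E)), ?_⟩
      ext z
      obtain ⟨x, rfl⟩ := e.surjective z
      have h1 := congrFun hfs x
      change f (e x) = θ X h (gluing E p q (e.symm (e x)))
      rw [e.symm_apply_apply]
      exact h1
    · rw [atomCover, dif_neg h]
      exact ⟨f, rfl⟩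

/-! ### Archimedean vector lattices with a distinguished strong unit -/

/-- An Archimedean (real) vector lattice with a distinguished strong unit. -/
structure WStar : Type (u + 1) where
  carrier : Type u
  [addCommGroup : AddCommGroup carrier]
  [module : Module ℝ carrier]
  [lattice : Lattice carrier]
  [isOrderedAddMonoid : IsOrderedAddMonoid carrier]
  [isOrderedModule : IsOrderedModule ℝ carrier]
  unit : carrier
  unit_nonneg : 0 ≤ unit
  archimedean : ∀ a b : carrier, (∀ n : ℕ, n • a ≤ b) → a ≤ 0
  strong : ∀ a : carrier, ∃ n : ℕ, |a| ≤ n • unit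

namespace WStar

attribute [instance] addCommGroup module lattice isOrderedAddMonoid isOrderedModule

instance : CoeSort WStar.{u} (Type u) := ⟨carrier⟩

/-- Morphisms: unit-preserving vector lattice homomorphisms. -/
structure Hom (A B : WStar.{u}) where
  toLinearMap : A →ₗ[ℝ] B
  map_sup : ∀ a b, toLinearMap (a ⊔ b) = toLinearMap a ⊔ toLinearMap b
  map_inf : ∀ a b, toLinearMap (a ⊓ b) = toLinearMap a ⊓ toLinearMap b
  map_unit : toLinearMap A.unit = B.unit

instance (A B : WStar.{u}) : CoeFun (Hom A B) (fun _ => A → B) := ⟨fun f => f.toLinearMap⟩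

/-- Composition of morphisms. -/
def Hom.comp {A B D : WStar.{u}} (g : Hom B D) (f : Hom A B) : Hom A D where
  toLinearMap := g.toLinearMap ∘ₗ f.toLinearMap
  map_sup a b := by simp [f.map_sup, g.map_sup]
  map_inf a b := by simp [f.map_inf, g.map_inf]
  map_unit := by simp [f.map_unit, g.map_unit]

/-- Essential embeddings. -/
def Hom.IsEssential {A B : WStar.{u}} (f : Hom A B) : Prop :=
  Function.Injective f ∧
    ∀ (D : WStar.{u}) (g : Hom B D), Function.Injective (g.comp f) → Function.Injective g

/-- A vector sublattice of `C(X)` that contains the constant `1`, as an Archimedean vector lattice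
with strong unit `1`. -/
def ofSubmodule (X : CompHaus.{u}) (S : Submodule ℝ C(X, ℝ)) (h1 : (1 : C(X, ℝ)) ∈ S)
    (hsup : ∀ f ∈ S, ∀ g ∈ S, f ⊔ g ∈ S) (hinf : ∀ f ∈ S, ∀ g ∈ S, f ⊓ g ∈ S) : WStar.{u} :=
  letI : Lattice S := Subtype.lattice (P := fun f => f ∈ S)
    (fun x y hx hy => hsup x hx y hy) (fun x y hx hy => hinf x hx y hy)
  { carrier := S
    isOrderedAddMonoid :=
      { add_le_add_left := fun a b hab c x => by
          have := hab x
          simpa using this }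
    isOrderedModule :=
      { smul_le_smul_of_nonneg_left := fun c hc a b hab x => by
          have := mul_le_mul_of_nonneg_left (hab x) hc
          simpa using this
        smul_le_smul_of_nonneg_right := fun a ha c d hcd x => by
          have := mul_le_mul_of_nonneg_right hcd (ha x)
          simpa using this }
    unit := ⟨1, h1⟩
    unit_nonneg := fun x => zero_le_one
    archimedean := fun a b hab x => by
      have hab' : ∀ n : ℕ, (n : ℝ) * a.1 x ≤ b.1 x := fun n => by
        have := hab n x
        simpa using this
      change a.1 x ≤ 0
      by_contra hpos
      push Not at hpos
      obtain ⟨n, hn⟩ := exists_nat_gt (b.1 x / a.1 x)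
      rw [div_lt_iff₀ hpos] at hn
      exact absurd (hab' n) (not_le.2 hn)
    strong := fun a => by
      obtain ⟨n, hn⟩ := exists_nat_ge ‖a.1‖
      refine ⟨n, fun x => ?_⟩
      have h2 : |a.1 x| ≤ (n : ℝ) := ((a.1).norm_coe_le_norm x).trans hn
      have h3 : a.1 x ⊔ -a.1 x ≤ (n : ℝ) := h2
      change a.1 x ⊔ -a.1 x ≤ _
      simpa using h3 }

/-- The vector lattice `C(X)`, with the constant `1` as unit. -/
def cont (X : CompHaus.{u}) : WStar.{u} :=
  ofSubmodule X ⊤ trivial (fun _ _ _ _ => trivial) (fun _ _ _ _ => trivial)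

/-- The vector lattice `F(X)` of those `f ∈ C(X)` that have only finitely many values. -/
def finiteRange (X : CompHaus.{u}) : WStar.{u} :=
  ofSubmodule X
    { carrier := {f | (range f).Finite}
      zero_mem' := (Set.finite_singleton (0 : ℝ)).subset (by rintro _ ⟨x, rfl⟩; rfl)
      add_mem' := fun {f g} hf hg => (Set.Finite.image2 (· + ·) hf hg).subset (by
        rintro _ ⟨x, rfl⟩
        exact ⟨f x, ⟨x, rfl⟩, g x, ⟨x, rfl⟩, rfl⟩)
      smul_mem' := fun c f hf => (Set.Finite.image (c * ·) hf).subset (by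
        rintro _ ⟨x, rfl⟩
        exact ⟨f x, ⟨x, rfl⟩, rfl⟩) }
    ((Set.finite_singleton (1 : ℝ)).subset (by rintro _ ⟨x, rfl⟩; rfl))
    (fun f hf g hg => (Set.Finite.image2 (· ⊔ ·) hf hg).subset (by
        rintro _ ⟨x, rfl⟩
        exact ⟨f x, ⟨x, rfl⟩, g x, ⟨x, rfl⟩, rfl⟩))
    (fun f hf g hg => (Set.Finite.image2 (· ⊓ ·) hf hg).subset (by
        rintro _ ⟨x, rfl⟩
        exact ⟨f x, ⟨x, rfl⟩, g x, ⟨x, rfl⟩, rfl⟩))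

/-- The morphism `F(X) → C(K)`, `f ↦ f ∘ π`, induced by a continuous map `π : K → X`. -/
def finiteRangeMap {X K : CompHaus.{u}} (π : C(K, X)) : Hom (finiteRange X) (cont K) where
  toLinearMap :=
    { toFun := fun f => (⟨f.1.comp π, trivial⟩ : (⊤ : Submodule ℝ C(K, ℝ)))
      map_add' := fun _ _ => rfl
      map_smul' := fun _ _ => rfl }
  map_sup _ _ := rfl
  map_inf _ _ := rfl
  map_unit := rfl

/-! ### The Yosida space and the Yosida embedding -/

/-- The set underlying the Yosida space of `A`: all unit-preserving vector lattice homomorphisms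
`A → ℝ` (equivalently, through their kernels, all ideals of `A` maximal with respect to not
containing the unit). -/
def realHoms (A : WStar.{u}) : Set (A → ℝ) :=
  {x | (∀ a b, x (a + b) = x a + x b) ∧ (∀ (c : ℝ) a, x (c • a) = c * x a) ∧
    (∀ a b, x (a ⊔ b) = x a ⊔ x b) ∧ (∀ a b, x (a ⊓ b) = x a ⊓ x b) ∧ x A.unit = 1}

theorem isClosed_realHoms (A : WStar.{u}) : IsClosed (realHoms A) := by
  simp only [realHoms, ofPred_and, ofPred_forall]
  refine IsClosed.inter ?_ (IsClosed.inter ?_ (IsClosed.inter ?_ (IsClosed.inter ?_ ?_)))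
  · exact isClosed_iInter fun a => isClosed_iInter fun b => isClosed_eq (by fun_prop) (by fun_prop)
  · exact isClosed_iInter fun a => isClosed_iInter fun b => isClosed_eq (by fun_prop) (by fun_prop)
  · exact isClosed_iInter fun a => isClosed_iInter fun b => isClosed_eq (by fun_prop) (by fun_prop)
  · exact isClosed_iInter fun a => isClosed_iInter fun b => isClosed_eq (by fun_prop) (by fun_prop)
  · exact isClosed_eq (by fun_prop) (by fun_prop)

instance compactSpace_realHoms (A : WStar.{u}) : CompactSpace (realHoms A) := by
  rw [← isCompact_iff_compactSpace]
  choose n hn using A.strong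
  refine (isCompact_univ_pi (s := fun a : A => Icc (-(n a : ℝ)) (n a))
    fun a => isCompact_Icc).of_isClosed_subset (isClosed_realHoms A) ?_
  rintro x ⟨hadd, hsmul, hsup, -, hunit⟩ a -
  have hmono : ∀ b c, b ≤ c → x b ≤ x c := fun b c hbc => by
    have h := hsup b c
    rw [sup_eq_right.2 hbc] at h
    rw [h]
    exact le_sup_left
  have hnat : x (n a • A.unit) = n a := by
    rw [← Nat.cast_smul_eq_nsmul ℝ, hsmul, hunit, mul_one]
  have hneg : x (-a) = -x a := by
    have := hsmul (-1) a
    simpa using this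
  have h1 := hmono _ _ ((le_abs_self a).trans (hn a))
  have h2 := hmono _ _ ((neg_le_abs a).trans (hn a))
  rw [hnat] at h1 h2
  rw [hneg] at h2
  exact ⟨by linarith, h1⟩

/-- The Yosida space `YA`, with the topology of pointwise convergence. -/
def yosida (A : WStar.{u}) : CompHaus.{u} := CompHaus.of (realHoms A)

/-- The Yosida embedding `ν_A`, followed by the map `C(YA) → C(Z)`, `f ↦ f ∘ π`, induced by a
continuous map `π : Z → YA`. -/
def yosidaMap (A : WStar.{u}) {Z : CompHaus.{u}} (π : C(Z, A.yosida)) : Hom A (cont Z) where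
  toLinearMap :=
    { toFun := fun a => (⟨⟨fun z => (π z).1 a,
        (continuous_apply a).comp (continuous_subtype_val.comp π.continuous)⟩, trivial⟩ :
          (⊤ : Submodule ℝ C(Z, ℝ)))
      map_add' := fun a b => Subtype.ext (ContinuousMap.ext fun z => (π z).2.1 a b)
      map_smul' := fun c a => Subtype.ext (ContinuousMap.ext fun z => (π z).2.2.1 c a) }
  map_sup a b := Subtype.ext (ContinuousMap.ext fun z => (π z).2.2.2.1 a b)
  map_inf a b := Subtype.ext (ContinuousMap.ext fun z => (π z).2.2.2.2.1 a b)
  map_unit := Subtype.ext (ContinuousMap.ext fun z => (π z).2.2.2.2.2)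

/-! ### The hull operators `μ(c)` and the posets `V(C(K), μ(c))` -/

/-- The pair `(μ(c)A, μ(c)_A)`, where `μ(c)A = C(cYA)` (recorded by the space `cYA`) and `μ(c)_A`
is the composite `A → C(YA) → C(cYA)`. The Yosida space is determined only up to homeomorphism, and
a copy `X` of it, with the identification `η : X → YA`, is used in its place. -/
def mu (c : CoveringOperator.{u}) (A : WStar.{u}) (X : CompHaus.{u}) (η : X ≃ₜ A.yosida) :
    Σ Z : CompHaus.{u}, Hom A (cont Z) :=
  ⟨(c.cover X).1, A.yosidaMap ((η : C(X, A.yosida)).comp (c.cover X).2)⟩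

/-- An object together with a morphism to `C(K)`. -/
structure Over (K : CompHaus.{u}) : Type (u + 1) where
  obj : WStar.{u}
  hom : Hom obj (cont K)

/-- The order on objects of which `C(K)` is an essential extension:
`(A₁, f₁) ≤ (A₂, f₂)` if `f₁ = f₂ ∘ f` for an essential embedding `f : A₁ → A₂`. -/
def Over.le {K : CompHaus.{u}} (P Q : Over K) : Prop :=
  ∃ f : Hom P.obj Q.obj, f.IsEssential ∧ P.hom = Q.hom.comp f

/-- `V(C(K), μ(c))`: all `A` with `μ(c)A = C(K)`, each identified with the pair `(A, μ(c)_A)`. -/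
def V (K : CompHaus.{u}) (c : CoveringOperator.{u}) : Set (Over K) :=
  {P | ∃ (X : CompHaus.{u}) (η : X ≃ₜ P.obj.yosida), mu c P.obj X η = ⟨K, P.hom⟩}

/-- `P` is the minimum of `V(C(K), μ(c))`. -/
def IsMinimum {K : CompHaus.{u}} (c : CoveringOperator.{u}) (P : Over K) : Prop :=
  P ∈ V K c ∧ ∀ Q ∈ V K c, P.le Q

end WStar

/-- A space is zero-dimensional if its clopen sets form a base. -/
def ZeroDimensional (X : Type u) [TopologicalSpace X] : Prop :=
  TopologicalSpace.IsTopologicalBasis {U : Set X | IsClopen U}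

end

namespace WStar

/-! ### Existence of real-valued homomorphisms -/

/-! Two facts carry the theorem.

Yosida representation. The real-valued homomorphisms of `A` separate its elements, so `A` is a
point-separating unital vector sublattice of `C(YA)` (`exists_realHom_pos`, `yosidaMap_injective`).
Such a sublattice is uniformly dense by Stone–Weierstrass. An approximation of a clopen indicator
can be sharpened to the indicator itself by lattice operations, so `A` contains every function of
finite range on `YA` (`mem_of_finite_range_of_separating`).

Order density. Let `K → Z → X` be surjections with irreducible composite, `X` zero-dimensional and
`Z` a copy of `YA`. Pulling back along `Z → X` embeds `F(X)` in `A`. If `0 < a` in `A`,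
irreducibility gives a nonempty open subset of `X` over which `a` exceeds a positive constant. A
multiple of a clopen indicator then lies below `a`, so the embedding is order dense and hence
essential (`finiteRange_le`).

By the form of the atom, the Yosida space of a member of `V(C(E))` is a copy of `E` or of the glued
space. Both lie between `E` and the glued space, which is zero-dimensional, so `F` of the glued
space is the minimum. For `Y` homeomorphic to neither, the members of `V(C(Y))` are exactly the
lattices with Yosida space `Y`, and the same argument makes `F(Y)` minimal when `Y` is
zero-dimensional. Conversely, for each `y` the functions constant near `y` form a member. A minimum
lies below all of these, so it consists of locally constant functions; these separate points, and
their fibres are clopen. -/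

/-- A gauge on `A`: a monotone, sublinear, supremum-preserving functional normalized at the unit.
On `C(X)` these are the functionals `f ↦ sup f(F)`, with `F` closed and nonempty. -/
structure IsGauge (A : WStar.{u}) (p : A → ℝ) : Prop where
  mono : Monotone p
  add : ∀ a b, p (a + b) ≤ p a + p b
  smul : ∀ t : ℝ, 0 < t → ∀ a, p (t • a) ≤ t * p a
  sup : ∀ a b, p (a ⊔ b) ≤ p a ⊔ p b
  unit : p A.unit ≤ 1
  neg_unit : p (-A.unit) ≤ -1

namespace IsGauge

variable {A : WStar.{u}} {p : A → ℝ}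

theorem map_zero (hp : IsGauge A p) : p 0 = 0 := by
  have h1 := hp.add 0 0
  have h2 := hp.add A.unit (-A.unit)
  have h3 := hp.unit
  have h4 := hp.neg_unit
  rw [add_zero] at h1
  rw [add_neg_cancel] at h2
  linarith

/-- Subadditivity at `r • A.unit + (-r) • A.unit = 0` turns the upper bounds `p (s • A.unit) ≤ s`
into equalities. -/
theorem map_smul_unit (hp : IsGauge A p) (r : ℝ) : p (r • A.unit) = r := by
  have key : ∀ s : ℝ, p (s • A.unit) ≤ s := by
    intro s
    rcases lt_trichotomy s 0 with hs | rfl | hs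
    · have h := hp.smul (-s) (by linarith) (-A.unit)
      rw [smul_neg, neg_smul, neg_neg] at h
      nlinarith [hp.neg_unit]
    · rw [zero_smul, hp.map_zero]
    · have h := hp.smul s hs A.unit
      nlinarith [hp.unit]
  have h1 := key r
  have h2 := key (-r)
  have h3 := hp.add (r • A.unit) (-r • A.unit)
  rw [neg_smul, add_neg_cancel, hp.map_zero] at h3
  rw [neg_smul] at h2
  linarith

theorem neg_le (hp : IsGauge A p) (a : A) : -p a ≤ p (-a) := by
  have h := hp.add a (-a)
  rw [add_neg_cancel, hp.map_zero] at h
  linarith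

theorem neg_nat_le (hp : IsGauge A p) {a : A} {n : ℕ} (h : |a| ≤ n • A.unit) : -(n : ℝ) ≤ p a := by
  have h1 : -a ≤ (n : ℝ) • A.unit := by
    rw [Nat.cast_smul_eq_nsmul]
    exact (neg_le_abs a).trans h
  have h2 : (-(n : ℝ)) • A.unit ≤ a := by
    rw [neg_smul]
    exact neg_le_of_neg_le h1
  have h3 := hp.mono h2
  rwa [hp.map_smul_unit] at h3

/-- A directed infimum of gauges, or more generally of functionals that satisfy the axioms of a
gauge up to a change of index, is a gauge. -/
theorem iInf {ι : Type*} [Nonempty ι] (q : ι → A → ℝ)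
    (bdd : ∀ a, BddBelow (range fun i => q i a)) (mono : ∀ i, Monotone (q i))
    (add : ∀ i j, ∃ k, ∀ a b, q k (a + b) ≤ q i a + q j b)
    (smul : ∀ t : ℝ, 0 < t → ∀ i, ∃ k, ∀ a, q k (t • a) ≤ t * q i a)
    (sup : ∀ i j, ∃ k, ∀ a b, q k (a ⊔ b) ≤ q i a ⊔ q j b)
    (unit : ∃ i, q i A.unit ≤ 1) (neg_unit : ∃ i, q i (-A.unit) ≤ -1) :
    IsGauge A (fun a => ⨅ i, q i a) where
  mono a b hab := ciInf_mono (bdd a) fun i => mono i hab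
  add a b := le_ciInf_add_ciInf fun i j => by
    obtain ⟨k, hk⟩ := add i j
    exact ciInf_le_of_le (bdd _) k (hk a b)
  smul t ht a := by
    rw [Real.mul_iInf_of_nonneg ht.le]
    refine le_ciInf fun i => ?_
    obtain ⟨k, hk⟩ := smul t ht i
    exact ciInf_le_of_le (bdd _) k (hk a)
  sup a b := by
    refine le_of_forall_gt_imp_ge_of_dense fun r hr => ?_
    obtain ⟨i, hi⟩ := exists_lt_of_ciInf_lt (le_sup_left.trans_lt hr)
    obtain ⟨j, hj⟩ := exists_lt_of_ciInf_lt (le_sup_right.trans_lt hr)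
    obtain ⟨k, hk⟩ := sup i j
    exact ciInf_le_of_le (bdd _) k ((hk a b).trans (sup_le hi.le hj.le))
  unit := by
    obtain ⟨i, hi⟩ := unit
    exact ciInf_le_of_le (bdd _) i hi
  neg_unit := by
    obtain ⟨i, hi⟩ := neg_unit
    exact ciInf_le_of_le (bdd _) i hi

/-- For every gauge `p` and every `c` there is a smaller gauge that takes the value `p c` at `c`,
and `-p c` at `-c`. -/
theorem exists_le_neg (hp : IsGauge A p) (c : A) :
    ∃ p', IsGauge A p' ∧ p' ≤ p ∧ p' (-c) ≤ -p c := by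
  set r := p c with hr
  -- If `p` is the supremum over a closed set `F`, then `d` vanishes on the part of `F` where `c`
  -- attains its maximum `r` and is negative on the rest. Adding `s • d` with `s` large penalizes
  -- the rest, so the infimum over `s` is the supremum over that part.
  set d : A := c ⊓ r • A.unit - r • A.unit with hd
  have hd0 : d ≤ 0 := sub_nonpos.2 inf_le_right
  -- Write `c` as `d + r • A.unit` plus the positive part of `c - r • A.unit`; `p` of that positive
  -- part is at most `0`, because `p c = r`.
  have hpd : 0 ≤ p d := by
    have h1 : c = (d + r • A.unit) + (c + (-r) • A.unit) ⊔ 0 := by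
      have h2 : (c + (-r) • A.unit) ⊔ 0 = c ⊔ r • A.unit - r • A.unit := by
        rw [neg_smul, ← sub_eq_add_neg, sup_sub, sub_self]
      rw [h2, hd, sub_add_cancel, ← add_sub_assoc, inf_add_sup, add_sub_cancel_right]
    have h3 := hp.add (d + r • A.unit) ((c + (-r) • A.unit) ⊔ 0)
    rw [← h1] at h3
    have h4 := hp.add d (r • A.unit)
    have h5 := hp.add c ((-r) • A.unit)
    rw [hp.map_smul_unit] at h4 h5
    have h6 := hp.sup (c + (-r) • A.unit) 0
    rw [hp.map_zero, sup_eq_right.2 (by linarith : p (c + (-r) • A.unit) ≤ 0)] at h6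
    linarith
  have hpsd : ∀ s : ℝ, 0 ≤ s → 0 ≤ p (s • d) := by
    intro s hs
    rcases hs.eq_or_lt with rfl | hs
    · rw [zero_smul, hp.map_zero]
    · have h := hp.smul s⁻¹ (inv_pos.2 hs) (s • d)
      rw [smul_smul, inv_mul_cancel₀ hs.ne', one_smul] at h
      exact nonneg_of_mul_nonneg_right (hpd.trans h) (inv_pos.2 hs)
  have hanti : ∀ s t : ℝ, s ≤ t → t • d ≤ s • d := fun s t hst => by
    have h := smul_nonneg (sub_nonneg.2 hst) (neg_nonneg.2 hd0)
    rw [smul_neg, sub_smul, neg_sub] at h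
    exact sub_nonneg.1 h
  have hbdd : ∀ a, BddBelow (range fun s : Ici (0 : ℝ) => p (a + s.1 • d)) := by
    refine fun a => ⟨-p (-a), ?_⟩
    rintro _ ⟨s, rfl⟩
    have h1 := hp.add (a + s.1 • d) (-a)
    rw [add_neg_cancel_comm] at h1
    have h2 := hpsd s.1 s.2
    change -p (-a) ≤ p (a + s.1 • d)
    linarith
  refine ⟨fun a => ⨅ s : Ici (0 : ℝ), p (a + s.1 • d), IsGauge.iInf _ hbdd ?_ ?_ ?_ ?_ ?_ ?_,
    fun a => ?_, ?_⟩
  · exact fun s a b hab => hp.mono (add_le_add_left hab _)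
  · refine fun s t => ⟨⟨s.1 + t.1, mem_Ici.2 (add_nonneg s.2 t.2)⟩, fun a b => ?_⟩
    have h := hp.add (a + s.1 • d) (b + t.1 • d)
    rwa [add_add_add_comm, ← add_smul] at h
  · refine fun t ht s => ⟨⟨t * s.1, mem_Ici.2 (mul_nonneg ht.le s.2)⟩, fun a => ?_⟩
    have h := hp.smul t ht (a + s.1 • d)
    rwa [smul_add, smul_smul] at h
  -- As `d ≤ 0`, the larger parameter gives the smaller value, so the maximum serves both terms.
  · refine fun s t => ⟨⟨s.1 ⊔ t.1, mem_Ici.2 (le_sup_of_le_left s.2)⟩, fun a b => ?_⟩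
    change p (a ⊔ b + (s.1 ⊔ t.1) • d) ≤ _
    rw [sup_add]
    refine (hp.sup _ _).trans (sup_le_sup (hp.mono ?_) (hp.mono ?_))
    · exact add_le_add_right (hanti _ _ le_sup_left) _
    · exact add_le_add_right (hanti _ _ le_sup_right) _
  · exact ⟨⟨0, mem_Ici.2 le_rfl⟩, by simpa using hp.unit⟩
  · exact ⟨⟨0, mem_Ici.2 le_rfl⟩, by simpa using hp.neg_unit⟩
  · exact ciInf_le_of_le (hbdd a) ⟨0, mem_Ici.2 le_rfl⟩ (by simp)
  -- Already `s = 1` suffices: `-c + d ≤ -r • A.unit`, since `d + r • A.unit ≤ c`.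
  · refine ciInf_le_of_le (hbdd _) ⟨1, mem_Ici.2 zero_le_one⟩ ?_
    rw [← hp.map_smul_unit (-r)]
    refine hp.mono ?_
    change -c + (1 : ℝ) • d ≤ _
    rw [one_smul, neg_smul, hd, add_sub, sub_eq_add_neg]
    exact add_le_of_nonpos_left (by rw [neg_add_nonpos_iff]; exact inf_le_left)

/-- A gauge that is odd is a unit-preserving vector lattice homomorphism. -/
theorem mem_realHoms (hp : IsGauge A p) (hodd : ∀ a, p (-a) = -p a) : p ∈ realHoms A := by
  have hsup : ∀ a b, p (a ⊔ b) = p a ⊔ p b := fun a b =>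
    (hp.sup a b).antisymm (sup_le (hp.mono le_sup_left) (hp.mono le_sup_right))
  have hpos : ∀ t : ℝ, 0 < t → ∀ a, p (t • a) = t * p a := by
    refine fun t ht a => (hp.smul t ht a).antisymm ?_
    have h := hp.smul t ht (-a)
    rw [smul_neg, hodd, hodd] at h
    linarith
  refine ⟨fun a b => (hp.add a b).antisymm ?_, fun c a => ?_, hsup, fun a b => ?_, ?_⟩
  · have h := hp.add (-a) (-b)
    rw [← neg_add, hodd, hodd, hodd] at h
    linarith
  · rcases lt_trichotomy c 0 with hc | rfl | hc
    · have h := hpos (-c) (by linarith) a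
      rw [neg_smul, hodd] at h
      linarith
    · rw [zero_smul, hp.map_zero, zero_mul]
    · exact hpos c hc a
  · have h := hodd (-a ⊔ -b)
    rw [neg_sup, neg_neg, neg_neg, hsup, hodd, hodd, neg_sup, neg_neg, neg_neg] at h
    exact h
  · simpa using hp.map_smul_unit 1

/-- Every gauge dominates a unit-preserving vector lattice homomorphism. -/
theorem exists_realHom_le (hp : IsGauge A p) : ∃ x ∈ realHoms A, x ≤ p := by
  -- Zorn in the dual order yields a minimal gauge; the pointwise infimum of a chain of gauges is a
  -- gauge, bounded below by the strong unit.
  obtain ⟨m, hm, hmin⟩ := zorn_le_nonempty₀ (α := (A → ℝ)ᵒᵈ)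
    {q | IsGauge A (OrderDual.ofDual q)} (by
      intro S hS hchain q₀ hq₀
      have : Nonempty S := ⟨⟨q₀, hq₀⟩⟩
      have hdir : ∀ i j : S, ∃ k : S, (∀ a, OrderDual.ofDual k.1 a ≤ OrderDual.ofDual i.1 a) ∧
          ∀ a, OrderDual.ofDual k.1 a ≤ OrderDual.ofDual j.1 a := by
        intro i j
        rcases hchain.total i.2 j.2 with h | h
        · exact ⟨j, h, fun a => le_rfl⟩
        · exact ⟨i, fun a => le_rfl, h⟩
      have hbdd : ∀ a : A, BddBelow (range fun i : S => OrderDual.ofDual i.1 a) := by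
        intro a
        obtain ⟨n, hn⟩ := A.strong a
        refine ⟨-(n : ℝ), ?_⟩
        rintro _ ⟨i, rfl⟩
        exact IsGauge.neg_nat_le (hS i.2) hn
      refine ⟨OrderDual.toDual fun a => ⨅ i : S, OrderDual.ofDual i.1 a, ?_, fun i hi a =>
        ciInf_le (hbdd a) ⟨i, hi⟩⟩
      refine IsGauge.iInf (fun (i : S) a => OrderDual.ofDual i.1 a) hbdd (fun i => (hS i.2).mono)
        (fun i j => ?_) (fun t ht i => ⟨i, (hS i.2).smul t ht⟩) (fun i j => ?_)
        ⟨⟨q₀, hq₀⟩, (hS hq₀).unit⟩ ⟨⟨q₀, hq₀⟩, (hS hq₀).neg_unit⟩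
      · obtain ⟨k, h1, h2⟩ := hdir i j
        exact ⟨k, fun a b => ((hS k.2).add a b).trans (add_le_add (h1 a) (h2 b))⟩
      · obtain ⟨k, h1, h2⟩ := hdir i j
        exact ⟨k, fun a b => ((hS k.2).sup a b).trans (sup_le_sup (h1 a) (h2 b))⟩)
    (OrderDual.toDual p) hp
  have hg : IsGauge A (OrderDual.ofDual m) := hmin.1
  refine ⟨OrderDual.ofDual m, hg.mem_realHoms fun a => le_antisymm ?_ (hg.neg_le a), hm⟩
  obtain ⟨p', hp', hle, hneg⟩ := hg.exists_le_neg a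
  -- By minimality `m ≤ p'`, so `m (-a) ≤ -m a`: a minimal gauge is odd.
  exact (hmin.2 (y := OrderDual.toDual p') hp' hle (-a)).trans hneg

end IsGauge

/-! ### The greatest gauge, and separation by real-valued homomorphisms -/

/-- The smallest multiple of the unit that dominates `a`. -/
noncomputable def upperBound (A : WStar.{u}) (a : A) : ℝ := sInf {t : ℝ | a ≤ t • A.unit}

/-- A nonzero unit keeps the set of dominating multiples bounded below. When the unit is `0` this
set is all of `ℝ`, and `sInf` takes its default value `0`. -/
theorem upperBound_le {A : WStar.{u}} (hA : A.unit ≠ 0) {a : A} {t : ℝ} (h : a ≤ t • A.unit) :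
    A.upperBound a ≤ t := by
  refine csInf_le ?_ h
  obtain ⟨n, hn⟩ := A.strong a
  refine ⟨-(n : ℝ), fun s hs => ?_⟩
  by_contra hlt
  push Not at hlt
  have h1 : 0 ≤ (n : ℝ) • A.unit + s • A.unit := by
    rw [Nat.cast_smul_eq_nsmul]
    exact (neg_le_iff_add_nonneg.1 ((neg_le_abs a).trans hn)).trans
      (add_le_add_right hs _)
  rw [← add_smul] at h1
  have h2 := smul_nonneg (inv_nonneg.2 (by linarith : 0 ≤ -((n : ℝ) + s))) h1
  rw [smul_smul, inv_neg, neg_mul, inv_mul_cancel₀ (by linarith), neg_one_smul] at h2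
  exact hA (le_antisymm (neg_nonneg.1 h2) A.unit_nonneg)

theorem le_smul_unit_of_upperBound_lt {A : WStar.{u}} {a : A} {t : ℝ} (h : A.upperBound a < t) :
    a ≤ t • A.unit := by
  obtain ⟨n, hn⟩ := A.strong a
  obtain ⟨s, hs, hst⟩ := exists_lt_of_csInf_lt (s := {t : ℝ | a ≤ t • A.unit}) ⟨(n : ℝ), by
    change a ≤ (n : ℝ) • A.unit
    rw [Nat.cast_smul_eq_nsmul]
    exact (le_abs_self a).trans hn⟩ h
  exact le_trans hs (smul_le_smul_of_nonneg_right hst.le A.unit_nonneg)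

theorem isGauge_upperBound {A : WStar.{u}} (hA : A.unit ≠ 0) : IsGauge A A.upperBound where
  mono a b hab := le_of_forall_gt_imp_ge_of_dense fun _ hr =>
    upperBound_le hA (hab.trans (le_smul_unit_of_upperBound_lt hr))
  add a b := le_of_forall_pos_le_add fun ε hε => by
    have h := add_le_add (le_smul_unit_of_upperBound_lt (lt_add_of_pos_right (A.upperBound a)
      (half_pos hε))) (le_smul_unit_of_upperBound_lt (lt_add_of_pos_right (A.upperBound b)
      (half_pos hε)))
    rw [← add_smul] at h
    exact (upperBound_le hA h).trans_eq (by ring)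
  smul t ht a := by
    have h : ∀ r, A.upperBound a < r → A.upperBound (t • a) ≤ t * r := fun r hr =>
      upperBound_le hA (by
        rw [mul_smul]
        exact smul_le_smul_of_nonneg_left (le_smul_unit_of_upperBound_lt hr) ht.le)
    rw [← div_le_iff₀' ht]
    exact le_of_forall_gt_imp_ge_of_dense fun r hr => (div_le_iff₀' ht).2 (h r hr)
  sup a b := le_of_forall_gt_imp_ge_of_dense fun _ hr => upperBound_le hA
    (sup_le (le_smul_unit_of_upperBound_lt (le_sup_left.trans_lt hr))
      (le_smul_unit_of_upperBound_lt (le_sup_right.trans_lt hr)))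
  unit := upperBound_le hA (one_smul ℝ _).ge
  neg_unit := upperBound_le hA (neg_one_smul ℝ _).ge

/-- The points of the Yosida space separate the elements of `A` from zero. -/
theorem exists_realHom_pos (A : WStar.{u}) {a : A} (ha : ¬ a ≤ 0) : ∃ x ∈ realHoms A, 0 < x a := by
  have hA : A.unit ≠ 0 := by
    intro h
    obtain ⟨n, hn⟩ := A.strong a
    rw [h, smul_zero] at hn
    exact ha ((le_abs_self a).trans hn)
  have hg := isGauge_upperBound hA
  -- Any homomorphism below this `p` satisfies `x (-a) ≤ -A.upperBound a`, that is, `A.upperBound a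
  -- ≤ x a`.
  obtain ⟨p, hp, -, hneg⟩ := hg.exists_le_neg a
  obtain ⟨x, hx, hxp⟩ := hp.exists_realHom_le
  refine ⟨x, hx, ?_⟩
  have h1 : 0 < A.upperBound a := by
    by_contra hle
    push Not at hle
    -- If the upper bound were at most `0`, then `a ≤ n⁻¹ • A.unit` for every `n > 0`, contrary to
    -- the Archimedean property.
    refine ha (A.archimedean a A.unit fun n => ?_)
    rcases Nat.eq_zero_or_pos n with rfl | hn
    · rw [zero_smul]
      exact A.unit_nonneg
    · have hn' : (0 : ℝ) < n := Nat.cast_pos.2 hn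
      have h := smul_le_smul_of_nonneg_left
        (le_smul_unit_of_upperBound_lt (hle.trans_lt (inv_pos.2 hn'))) hn'.le
      rwa [smul_smul, mul_inv_cancel₀ hn'.ne', one_smul, Nat.cast_smul_eq_nsmul] at h
  have h2 := (hxp (-a)).trans hneg
  have h3 := hx.2.1 (-1) a
  rw [neg_one_smul] at h3
  linarith

end WStar

/-! ### Functions of finite range in separating sublattices of `C(X)` -/

theorem isClopen_preimage_singleton_of_finite_range {X : Type*} [TopologicalSpace X] (f : C(X, ℝ))
    (hf : (range f).Finite) (r : ℝ) : IsClopen (f ⁻¹' {r}) := by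
  refine ⟨isClosed_singleton.preimage f.continuous, ?_⟩
  have h : f ⁻¹' {r} = (f ⁻¹' (range f \ {r}))ᶜ := by
    ext x
    simp
  rw [h, isOpen_compl_iff]
  exact hf.sdiff.isClosed.preimage f.continuous

/-- The characteristic function of a clopen set. -/
noncomputable def clopenIndicator {X : Type*} [TopologicalSpace X] {U : Set X} (hU : IsClopen U) :
    C(X, ℝ) :=
  ⟨U.indicator 1, continuous_one.indicator (by simp [hU.frontier_eq])⟩

section Sublattice

variable {X : CompHaus.{u}} {S : Submodule ℝ C(X, ℝ)} (h1 : (1 : C(X, ℝ)) ∈ S)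
  (hsup : ∀ f ∈ S, ∀ g ∈ S, f ⊔ g ∈ S) (hinf : ∀ f ∈ S, ∀ g ∈ S, f ⊓ g ∈ S)
  (hsep : ∀ x y : X, x ≠ y → ∃ f ∈ S, f x ≠ f y)

include h1 hsup hinf hsep

/-- Density alone gives only approximations, but a two-valued function can be recovered exactly from
a close one by an affine map followed by truncation. -/
theorem clopenIndicator_mem_of_separating {U : Set X} (hU : IsClopen U) :
    clopenIndicator hU ∈ S := by
  have hdense : closure (S : Set C(X, ℝ)) = ⊤ := by
    refine ContinuousMap.sublattice_closure_eq_top _ ⟨1, h1⟩ hinf hsup fun v x y => ?_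
    by_cases hxy : x = y
    · subst hxy
      exact ⟨v x • 1, S.smul_mem _ h1, by simp⟩
    · obtain ⟨f, hf, hne⟩ := hsep x y hxy
      have hne' : f y - f x ≠ 0 := sub_ne_zero.2 (Ne.symm hne)
      refine ⟨v x • 1 + ((v y - v x) / (f y - f x)) • (f - f x • 1),
        S.add_mem (S.smul_mem _ h1) (S.smul_mem _ (S.sub_mem hf (S.smul_mem _ h1))), ?_, ?_⟩
      · simp
      · simp [div_mul_cancel₀ _ hne']
  obtain ⟨g, hg, hdist⟩ := Metric.mem_closure_iff.1
    (hdense ▸ mem_univ _ : clopenIndicator hU ∈ closure (S : Set C(X, ℝ))) (1 / 4) (by norm_num)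
  have hval : ∀ x, |clopenIndicator hU x - g x| < 1 / 4 := fun x =>
    (ContinuousMap.dist_apply_le_dist x).trans_lt hdist
  -- The map `t ↦ 2t - 1/2` sends `1/4` to `0` and `3/4` to `1`, while `g > 3/4` on `U` and `g <
  -- 1/4` off `U`.
  have heq : clopenIndicator hU = (((2 : ℝ) • g - (1 / 2 : ℝ) • 1) ⊔ 0) ⊓ 1 := by
    ext x
    have hx := abs_lt.1 (hval x)
    change U.indicator 1 x = ((2 * g x - 1 / 2 * 1) ⊔ 0) ⊓ (1 : ℝ)
    change _ < U.indicator 1 x - g x ∧ U.indicator 1 x - g x < _ at hx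
    by_cases hxU : x ∈ U
    · rw [indicator_of_mem hxU] at hx ⊢
      simp only [Pi.one_apply] at hx ⊢
      rw [inf_eq_right.2]
      exact le_sup_of_le_left (by linarith)
    · rw [indicator_of_notMem hxU] at hx ⊢
      rw [sup_eq_right.2 (by linarith), inf_eq_left.2 zero_le_one]
  rw [heq]
  exact hinf _ (hsup _ (S.sub_mem (S.smul_mem _ hg) (S.smul_mem _ h1)) _ S.zero_mem) _ h1

/-- A separating unital vector sublattice of `C(X)` contains the functions of finite range. -/
theorem mem_of_finite_range_of_separating {f : C(X, ℝ)} (hf : (range f).Finite) : f ∈ S := by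
  have heq : f = ∑ r ∈ hf.toFinset,
      r • clopenIndicator (isClopen_preimage_singleton_of_finite_range f hf r) := by
    ext x
    rw [ContinuousMap.sum_apply, Finset.sum_eq_single (f x)]
    · simp [clopenIndicator]
    · intro r _ hr
      simp [clopenIndicator, hr.symm]
    · intro h
      exact absurd (hf.mem_toFinset.2 (mem_range_self x)) h
  rw [heq]
  exact S.sum_mem fun r _ => S.smul_mem _
    (clopenIndicator_mem_of_separating h1 hsup hinf hsep _)

/-- The Yosida space of a separating unital vector sublattice of `C(X)` is `X`. -/
theorem WStar.exists_homeomorph_yosida_ofSubmodule :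
    ∃ e : X ≃ₜ (WStar.ofSubmodule X S h1 hsup hinf).yosida, ∀ z (f : S), (e z).1 f = f.1 z := by
  let ev : X → (WStar.ofSubmodule X S h1 hsup hinf).yosida := fun z =>
    ⟨fun f : S => f.1 z, fun _ _ => rfl, fun _ _ => rfl, fun _ _ => rfl, fun _ _ => rfl, rfl⟩
  have hcont : Continuous ev :=
    Continuous.subtype_mk (continuous_pi fun f : S => f.1.continuous) _
  have hinj : Function.Injective ev := by
    intro z w hzw
    by_contra hne
    obtain ⟨f, hf, hfne⟩ := hsep z w hne
    exact hfne (congrFun (congrArg Subtype.val hzw) (⟨f, hf⟩ : S))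
  have hsurj : Function.Surjective ev := by
    rintro ⟨x, hadd, hsmul, hxsup, -, hunit⟩
    let xl : S →ₗ[ℝ] ℝ := { toFun := x, map_add' := hadd, map_smul' := hsmul }
    have hxl : ∀ f g : S, xl ⟨f.1 ⊔ g.1, hsup _ f.2 _ g.2⟩ = xl f ⊔ xl g := hxsup
    have hone : xl ⟨1, h1⟩ = 1 := hunit
    by_contra hno
    -- If `x` is no evaluation, each `z` has a nonnegative element of the kernel of `x` that is
    -- positive at `z`. By compactness a finite sum of these is bounded below by some `ε > 0` and is
    -- still killed by `x`.
    have hz : ∀ z, ∃ f : S, xl f ≠ f.1 z := by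
      intro z
      by_contra h
      push Not at h
      exact hno ⟨z, Subtype.ext (funext fun f => (h f).symm)⟩
    choose f hf using hz
    let d : X → S := fun z => f z - xl (f z) • ⟨1, h1⟩
    have hd : ∀ z, xl (d z) = 0 := fun z => by
      rw [map_sub, map_smul, hone, smul_eq_mul, mul_one, sub_self]
    let g : X → S := fun z => ⟨(d z).1 ⊔ (-d z).1, hsup _ (d z).2 _ (-d z).2⟩
    have hg : ∀ z, xl (g z) = 0 := fun z => by
      rw [hxl, map_neg, hd, neg_zero, sup_idem]
    have hgy : ∀ z y, (g z).1 y = |(d z).1 y| := fun z y => rfl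
    have hgz : ∀ z, 0 < (g z).1 z := fun z => by
      rw [hgy, abs_pos]
      simpa [d, sub_eq_zero] using (hf z).symm
    obtain ⟨t, ht⟩ := isCompact_univ.elim_finite_subcover (fun z => {y | 0 < (g z).1 y})
      (fun z => isOpen_lt continuous_const (g z).1.continuous)
      (fun z _ => mem_iUnion.2 ⟨z, hgz z⟩)
    let G : S := ∑ z ∈ t, g z
    have hG : xl G = 0 := by
      rw [map_sum]
      exact Finset.sum_eq_zero fun z _ => hg z
    have hGy : ∀ y, G.1 y = ∑ z ∈ t, (g z).1 y := fun y => by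
      simp [G, ContinuousMap.sum_apply]
    have hGpos : ∀ y, 0 < G.1 y := by
      intro y
      obtain ⟨z, hz, hzy⟩ := mem_iUnion₂.1 (ht (mem_univ y))
      rw [hGy]
      exact Finset.sum_pos' (fun w _ => by rw [hgy]; exact abs_nonneg _) ⟨z, hz, hzy⟩
    obtain ⟨ε, hε, hεG⟩ : ∃ ε : ℝ, 0 < ε ∧ ∀ y, ε ≤ G.1 y := by
      rcases isEmpty_or_nonempty X with hX | hX
      · exact ⟨1, one_pos, fun y => (hX.false y).elim⟩
      · obtain ⟨y, -, hy⟩ := isCompact_univ.exists_isMinOn univ_nonempty G.1.continuous.continuousOn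
        exact ⟨G.1 y, hGpos y, fun w => hy (mem_univ w)⟩
    -- Since `G ⊔ ε = G`, applying `x` gives `0 = 0 ⊔ ε`, which is impossible.
    have h := hxl G (ε • ⟨1, h1⟩)
    have hsupG : G.1 ⊔ (ε • (⟨1, h1⟩ : S)).1 = G.1 := sup_eq_left.2 fun y => by
      simpa using hεG y
    have hG' : (⟨G.1 ⊔ (ε • (⟨1, h1⟩ : S)).1, hsup _ G.2 _ (ε • (⟨1, h1⟩ : S)).2⟩ : S) = G :=
      Subtype.ext hsupG
    rw [hG', hG, map_smul, hone, smul_eq_mul, mul_one] at h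
    exact absurd (h ▸ le_sup_right : ε ≤ 0) (not_le.2 hε)
  exact ⟨((isHomeomorph_iff_continuous_bijective).2 ⟨hcont, hinj, hsurj⟩).homeomorph,
    fun _ _ => rfl⟩

end Sublattice

/-! ### Zero-dimensional compact spaces -/

theorem zeroDimensional_of_separating {X : CompHaus.{u}}
    (h : ∀ x y : X, x ≠ y → ∃ U : Set X, IsClopen U ∧ x ∈ U ∧ y ∉ U) : ZeroDimensional X := by
  have : TotallySeparatedSpace X := totallySeparatedSpace_iff_exists_isClopen.2 h
  exact isTopologicalBasis_isClopen

theorem ZeroDimensional.exists_clopen_separating {X : Type u} [TopologicalSpace X] [T2Space X]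
    (h : ZeroDimensional X) {x y : X} (hxy : x ≠ y) : ∃ U : Set X, IsClopen U ∧ x ∈ U ∧ y ∉ U := by
  obtain ⟨U, hU, hxU, hUy⟩ := h.exists_subset_of_mem_open
    (show x ∈ ({y}ᶜ : Set X) from hxy) isOpen_compl_singleton
  exact ⟨U, hU, hxU, fun hy => hUy hy rfl⟩

theorem zeroDimensional_of_extremallyDisconnected (E : CompHaus.{u}) [ExtremallyDisconnected E] :
    ZeroDimensional E :=
  isTopologicalBasis_isClopen

/-- Clopen sets of `E` that contain both or neither of `p`, `q` descend to clopen sets of the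
quotient. Of two distinct points of the quotient at least one is not the glued point, and it can be
separated from the other point together with `p` and `q`. -/
theorem zeroDimensional_glued (E : CompHaus.{u}) [ExtremallyDisconnected E] (p q : E) :
    ZeroDimensional (glued E p q) := by
  have hE := zeroDimensional_of_extremallyDisconnected E
  have hγ : IsQuotientMap (gluing E p q) := isQuotientMap_quotient_mk'
  have key : ∀ U : Set E, IsClopen U → (p ∈ U ↔ q ∈ U) →
      IsClopen (gluing E p q '' U) ∧ ∀ x, gluing E p q x ∈ gluing E p q '' U ↔ x ∈ U := by
    intro U hU hpq
    have hmem : ∀ x, gluing E p q x ∈ gluing E p q '' U ↔ x ∈ U := by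
      refine fun x => ⟨?_, mem_image_of_mem _⟩
      rintro ⟨y, hy, hyx⟩
      rcases gluing_eq_iff.1 hyx with rfl | ⟨rfl | rfl, rfl | rfl⟩
      · exact hy
      · exact hy
      · exact hpq.1 hy
      · exact hpq.2 hy
      · exact hy
    refine ⟨?_, hmem⟩
    rw [← hγ.isClopen_preimage]
    rwa [show gluing E p q ⁻¹' (gluing E p q '' U) = U from Set.ext hmem]
  have key2 : ∀ x y : E, gluing E p q x ≠ gluing E p q y → ¬ (y = p ∨ y = q) →
      ∃ U : Set E, IsClopen U ∧ x ∈ U ∧ p ∈ U ∧ q ∈ U ∧ y ∉ U := by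
    intro x y hxy hy
    push Not at hy
    obtain ⟨U, hU, hxU, hyU⟩ := hE.exists_clopen_separating (fun h => hxy (congrArg _ h) : x ≠ y)
    obtain ⟨V, hV, hpV, hyV⟩ := hE.exists_clopen_separating hy.1.symm
    obtain ⟨W, hW, hqW, hyW⟩ := hE.exists_clopen_separating hy.2.symm
    refine ⟨U ∪ (V ∪ W), hU.union (hV.union hW), Or.inl hxU, Or.inr (Or.inl hpV),
      Or.inr (Or.inr hqW), ?_⟩
    rintro (h | h | h)
    exacts [hyU h, hyV h, hyW h]
  refine zeroDimensional_of_separating fun a b => ?_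
  obtain ⟨x, rfl⟩ := hγ.surjective a
  obtain ⟨y, rfl⟩ := hγ.surjective b
  intro hab
  by_cases hy : y = p ∨ y = q
  · have hx : ¬ (x = p ∨ x = q) := fun hx => hab (gluing_eq_iff.2 (Or.inr ⟨hx, hy⟩))
    obtain ⟨U, hU, hyU, hpU, hqU, hxU⟩ := key2 y x hab.symm hx
    obtain ⟨hc, hm⟩ := key U hU ⟨fun _ => hqU, fun _ => hpU⟩
    exact ⟨_, hc.compl, fun h => hxU ((hm x).1 h), fun h => h ((hm y).2 hyU)⟩
  · obtain ⟨U, hU, hxU, hpU, hqU, hyU⟩ := key2 x y hab hy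
    obtain ⟨hc, hm⟩ := key U hU ⟨fun _ => hqU, fun _ => hpU⟩
    exact ⟨_, hc, (hm x).2 hxU, fun h => hyU ((hm y).1 h)⟩

namespace WStar

/-! ### Morphisms -/

theorem Hom.ext' {A B : WStar.{u}} {f g : Hom A B} (h : ∀ a, f a = g a) : f = g := by
  cases f
  cases g
  congr
  exact LinearMap.ext h

theorem Hom.monotone {A B : WStar.{u}} (f : Hom A B) {a b : A} (h : a ≤ b) : f a ≤ f b := by
  have h1 := f.map_sup a b
  rw [sup_eq_right.2 h] at h1
  rw [h1]
  exact le_sup_left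

theorem Hom.le_of_map_le {A B : WStar.{u}} (f : Hom A B) (hf : Function.Injective f) {a b : A}
    (h : f a ≤ f b) : a ≤ b := by
  have h1 := f.map_inf a b
  rw [inf_eq_left.2 h] at h1
  exact inf_eq_left.1 (hf h1)

/-- A morphism whose values lie in the range of an embedding factors through the embedding. -/
theorem Hom.exists_factorization {A B D : WStar.{u}} (φ : Hom A D) (hφ : Function.Injective φ)
    (ψ : Hom B D) (h : ∀ b, ∃ a, φ a = ψ b) : ∃ f : Hom B A, ψ = φ.comp f := by
  choose f hf using h
  refine ⟨⟨⟨⟨f, fun a b => hφ ?_⟩, fun c a => hφ ?_⟩, fun a b => hφ ?_, fun a b => hφ ?_, hφ ?_⟩,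
    Hom.ext' fun b => (hf b).symm⟩
  · rw [map_add, hf, hf, hf, map_add]
  · rw [RingHom.id_apply, map_smul, hf, hf, map_smul]
  · change φ (f _) = φ (f _ ⊔ f _)
    rw [φ.map_sup, hf, hf, hf, ψ.map_sup]
  · change φ (f _) = φ (f _ ⊓ f _)
    rw [φ.map_inf, hf, hf, hf, ψ.map_inf]
  · change φ (f _) = _
    rw [hf, φ.map_unit, ψ.map_unit]

/-- An embedding with order dense range is essential. -/
theorem Hom.isEssential_of_orderDense {A B : WStar.{u}} (f : Hom B A) (hf : Function.Injective f)
    (h : ∀ a, 0 ≤ a → a ≠ 0 → ∃ b, b ≠ 0 ∧ 0 ≤ f b ∧ f b ≤ a) : f.IsEssential := by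
  refine ⟨hf, fun D g hg => (injective_iff_map_eq_zero g.toLinearMap).2 fun a ha => ?_⟩
  by_contra hne
  have hpos : 0 ≤ a ⊔ -a := abs_nonneg a
  have habs : g (a ⊔ -a) = 0 := by
    rw [g.map_sup, map_neg, ha, neg_zero, sup_idem]
  -- If `g` kills `a` it kills `|a|`, hence also `f b`, which lies between `0` and `|a|`;
  -- injectivity of `g ∘ f` then forces `b = 0`.
  obtain ⟨b, hb0, hb1, hb2⟩ := h (a ⊔ -a) hpos fun h0 =>
    hne (le_antisymm (h0 ▸ le_sup_left) (neg_nonpos.1 (h0 ▸ le_sup_right)))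
  have h1 := g.monotone hb1
  have h2 := g.monotone hb2
  rw [habs] at h2
  rw [map_zero] at h1
  refine hb0 (hg ?_)
  rw [map_zero]
  exact le_antisymm h2 h1

/-! ### Yosida representations and functions of finite range -/

theorem yosidaMap_injective (A : WStar.{u}) {Z : CompHaus.{u}} (π : C(Z, A.yosida))
    (hπ : Function.Surjective π) : Function.Injective (A.yosidaMap π) := by
  refine (injective_iff_map_eq_zero (A.yosidaMap π).toLinearMap).2 fun a ha => ?_
  have key : ∀ x ∈ realHoms A, x a = 0 := by
    intro x hx
    obtain ⟨z, hz⟩ := hπ ⟨x, hx⟩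
    have h := congrArg (fun f : (⊤ : Submodule ℝ C(Z, ℝ)) => f.1 z) ha
    change (π z).1 a = 0 at h
    rwa [hz] at h
  by_contra hne
  by_cases hle : a ≤ 0
  · obtain ⟨x, hx, hpos⟩ := A.exists_realHom_pos (a := -a) fun h =>
      hne (le_antisymm hle (neg_nonpos.1 h))
    have h := hx.2.1 (-1) a
    rw [neg_one_smul, key x hx] at h
    linarith
  · obtain ⟨x, hx, hpos⟩ := A.exists_realHom_pos hle
    exact hpos.ne' (key x hx)

/-- The Yosida representation of `A` on a copy of its Yosida space contains the functions of
finite range. -/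
theorem exists_eq_of_finite_range (A : WStar.{u}) {Z : CompHaus.{u}} (h : Z ≃ₜ A.yosida)
    {b : C(Z, ℝ)} (hb : (range b).Finite) : ∃ a, ∀ z, (h z).1 a = b z := by
  let S : Submodule ℝ C(Z, ℝ) :=
    { carrier := {g | ∃ a, ∀ z, (h z).1 a = g z}
      zero_mem' := ⟨0, fun z => by simpa using (h z).2.2.1 0 0⟩
      add_mem' := by
        rintro f g ⟨a, ha⟩ ⟨b, hb⟩
        exact ⟨a + b, fun z => by rw [(h z).2.1, ha, hb]; rfl⟩
      smul_mem' := by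
        rintro c f ⟨a, ha⟩
        exact ⟨c • a, fun z => by rw [(h z).2.2.1, ha]; rfl⟩ }
  refine mem_of_finite_range_of_separating (S := S) ?_ ?_ ?_ ?_ hb
  · exact ⟨A.unit, fun z => (h z).2.2.2.2.2⟩
  · rintro f ⟨a, ha⟩ g ⟨b, hb⟩
    exact ⟨a ⊔ b, fun z => by rw [(h z).2.2.2.1, ha, hb]; rfl⟩
  · rintro f ⟨a, ha⟩ g ⟨b, hb⟩
    exact ⟨a ⊓ b, fun z => by rw [(h z).2.2.2.2.1, ha, hb]; rfl⟩
  · intro z w hzw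
    by_contra hno
    push Not at hno
    refine hzw (h.injective (Subtype.ext (funext fun a => ?_)))
    exact hno ⟨fun z => (h z).1 a,
      (continuous_apply a).comp (continuous_subtype_val.comp h.continuous)⟩ ⟨a, fun z => rfl⟩

/-- The functions of finite range on the base of a cover `ρ : K → X` lie below every `A` whose
Yosida space is situated between `K` and `X`, if `X` is zero-dimensional. -/
theorem finiteRange_le {X Z K : CompHaus.{u}} (hX : ZeroDimensional X) {ρ : C(K, X)}
    (hρ : IsCover ρ) (π : C(K, Z)) (hπ : Function.Surjective π) (σ : C(Z, X))
    (hσ : ρ = σ.comp π) (A : WStar.{u}) (h : Z ≃ₜ A.yosida) :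
    Over.le ⟨finiteRange X, finiteRangeMap ρ⟩
      ⟨A, A.yosidaMap ((h : C(Z, A.yosida)).comp π)⟩ := by
  have hinj := A.yosidaMap_injective ((h : C(Z, A.yosida)).comp π) (h.surjective.comp hπ)
  obtain ⟨f, hf⟩ := Hom.exists_factorization (A.yosidaMap ((h : C(Z, A.yosida)).comp π)) hinj
    (finiteRangeMap ρ) (by
      rintro ⟨b, hb⟩
      -- The pullback of `b` to `Z` still has finite range, so it is represented by an element of
      -- `A`.
      obtain ⟨a, ha⟩ := A.exists_eq_of_finite_range h (b := b.comp σ)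
        (Set.Finite.subset hb (range_comp_subset_range σ b))
      refine ⟨a, Subtype.ext (ContinuousMap.ext fun z => (ha (π z)).trans ?_)⟩
      subst hσ
      rfl)
  have hval : ∀ (b : finiteRange X) z, (h (π z)).1 (f b) =
      (b : { f : C(X, ℝ) // (range f).Finite }).1 (ρ z) := by
    intro b z
    have := congrArg (fun g : Hom (finiteRange X) (cont K) =>
      (show (⊤ : Submodule ℝ C(K, ℝ)) from g b).1 z) hf
    exact this.symm
  refine ⟨f, Hom.isEssential_of_orderDense f ?_ ?_, hf⟩
  · intro b c hbc
    refine Subtype.ext (ContinuousMap.ext fun x => ?_)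
    obtain ⟨z, rfl⟩ := hρ.1 x
    exact (hval b z).symm.trans ((congrArg (h (π z)).1 hbc).trans (hval c z))
  · intro a ha0 hane
    let g : C(K, ℝ) := ⟨fun z => (h (π z)).1 a, (continuous_apply a).comp
      (continuous_subtype_val.comp (h.continuous.comp π.continuous))⟩
    have hg0 : ∀ z, 0 ≤ g z := by
      have h0 := (A.yosidaMap ((h : C(Z, A.yosida)).comp π)).monotone ha0
      rw [map_zero] at h0
      exact h0
    obtain ⟨z, hz⟩ : ∃ z, 0 < g z := by
      by_contra hno
      push Not at hno
      refine hane (hinj (Subtype.ext (ContinuousMap.ext fun z => ?_)))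
      rw [map_zero]
      exact le_antisymm (hno z) (hg0 z)
    -- This closed set misses `z`, so by irreducibility its image under `ρ` is not all of `X`. On
    -- the preimage of a clopen `U` disjoint from that image, `g` exceeds `g z / 2`.
    have hF : IsClosed {w | g w ≤ g z / 2} := isClosed_le g.continuous continuous_const
    have hFne : {w | g w ≤ g z / 2} ≠ univ := by
      intro hu
      have : g z ≤ g z / 2 := (hu ▸ mem_univ z : z ∈ {w | g w ≤ g z / 2})
      linarith
    obtain ⟨x, hx⟩ := nonempty_compl.2 (hρ.2 _ hF hFne)
    obtain ⟨U, hU, hxU, hUF⟩ := hX.exists_subset_of_mem_open hx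
      (hF.isCompact.image ρ.continuous).isClosed.isOpen_compl
    have hUfin : (range ((g z / 2) • clopenIndicator hU)).Finite := by
      refine (Set.toFinite {0, g z / 2}).subset ?_
      rintro _ ⟨y, rfl⟩
      by_cases hy : y ∈ U <;> simp [clopenIndicator, hy]
    have hval' : ∀ w, (h (π w)).1 (f ⟨(g z / 2) • clopenIndicator hU, hUfin⟩) =
        g z / 2 * U.indicator 1 (ρ w) := hval _
    refine ⟨⟨(g z / 2) • clopenIndicator hU, hUfin⟩, fun h0 => ?_, ?_, ?_⟩
    · have h1 := congrArg (fun b : { f : C(X, ℝ) // (range f).Finite } => b.1 x) h0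
      change g z / 2 * U.indicator 1 x = 0 at h1
      rw [indicator_of_mem hxU, Pi.one_apply] at h1
      linarith
    · refine Hom.le_of_map_le _ hinj ?_
      rw [map_zero]
      intro w
      change 0 ≤ (h (π w)).1 (f _)
      rw [hval']
      exact mul_nonneg (by linarith) (indicator_nonneg (fun _ _ => zero_le_one) _)
    · refine Hom.le_of_map_le _ hinj fun w => ?_
      change (h (π w)).1 (f _) ≤ g w
      rw [hval']
      by_cases hw : ρ w ∈ U
      · rw [indicator_of_mem hw, Pi.one_apply, mul_one]
        by_contra hlt
        exact hUF hw ⟨w, (not_le.1 hlt).le, rfl⟩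
      · rw [indicator_of_notMem hw, mul_zero]
        exact hg0 w

/-- Zero-dimensionality makes `F(X)` separate points, so evaluation identifies `X` with its Yosida
space. One identification serves every `ρ`. -/
theorem exists_finiteRangeMap_eq_yosidaMap {X : CompHaus.{u}} (hX : ZeroDimensional X) :
    ∃ e : X ≃ₜ (finiteRange X).yosida, ∀ {K : CompHaus.{u}} (ρ : C(K, X)),
      finiteRangeMap ρ = (finiteRange X).yosidaMap ((e : C(X, (finiteRange X).yosida)).comp ρ) := by
  have h : ∃ e : X ≃ₜ (finiteRange X).yosida,
      ∀ z (f : { f : C(X, ℝ) // (range f).Finite }), (e z).1 f = f.1 z := by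
    refine exists_homeomorph_yosida_ofSubmodule _ _ _ fun x y hxy => ?_
    obtain ⟨U, hU, hxU, hyU⟩ := hX.exists_clopen_separating hxy
    refine ⟨clopenIndicator hU, (Set.toFinite {0, 1}).subset ?_, ?_⟩
    · rintro _ ⟨y, rfl⟩
      by_cases hy : y ∈ U <;> simp [clopenIndicator, hy]
    · simp [clopenIndicator, hxU, hyU]
  obtain ⟨e, he⟩ := h
  exact ⟨e, fun ρ => Hom.ext' fun f => Subtype.ext (ContinuousMap.ext fun z => (he (ρ z) f).symm)⟩

/-! ### Functions that are constant near a point -/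

theorem exists_eventually_const_separating {Y : Type*} [TopologicalSpace Y] [CompactSpace Y]
    [T2Space Y] (y : Y) {s t : Y} (hst : s ≠ t) :
    ∃ f : C(Y, ℝ), (∀ᶠ z in 𝓝 y, f z = f y) ∧ f s ≠ f t := by
  -- One of the two points differs from `y`; a Urysohn function that is `1` there and `0` at the
  -- other point and on a closed neighbourhood of `y` will do.
  have key : ∀ s t : Y, s ≠ t → t ≠ y → ∃ f : C(Y, ℝ), (∀ᶠ z in 𝓝 y, f z = f y) ∧ f s ≠ f t := by
    intro s t hst hty
    obtain ⟨C, hC, hCcl, hCt⟩ := exists_mem_nhds_isClosed_subset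
      (isOpen_compl_singleton.mem_nhds (show y ∈ ({t}ᶜ : Set Y) from hty.symm))
    obtain ⟨f, hf0, hf1, -⟩ := exists_continuous_zero_one_of_isClosed
      (hCcl.union (isClosed_singleton (x := s))) (isClosed_singleton (x := t)) (by
        rw [disjoint_singleton_right]
        rintro (h | h)
        · exact hCt h rfl
        · exact hst h.symm)
    refine ⟨f, ?_, ?_⟩
    · filter_upwards [hC] with z hz
      exact (hf0 (Or.inl hz)).trans (hf0 (Or.inl (mem_of_mem_nhds hC))).symm
    · rw [hf0 (Or.inr rfl), hf1 rfl]
      exact zero_ne_one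
  by_cases hty : t = y
  · obtain ⟨f, hf, hne⟩ := key t s hst.symm fun h => hst (h.trans hty.symm)
    exact ⟨f, hf, hne.symm⟩
  · exact key s t hst hty

/-- The functions that are constant in a neighbourhood of `y`. -/
def constNear (Y : CompHaus.{u}) (y : Y) : Submodule ℝ C(Y, ℝ) where
  carrier := {f | ∀ᶠ z in 𝓝 y, f z = f y}
  zero_mem' := Filter.Eventually.of_forall fun _ => rfl
  add_mem' hf hg := by
    filter_upwards [hf, hg] with z h1 h2
    simp [h1, h2]
  smul_mem' c f hf := by
    filter_upwards [hf] with z h1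
    simp [h1]

/-- These lattices test a candidate minimum one point at a time; they exist with Yosida space `Y`
whether or not `Y` is zero-dimensional. -/
theorem exists_homeomorph_constNear (Y : CompHaus.{u}) (y : Y) : ∃ (A : WStar.{u})
    (e : Y ≃ₜ A.yosida), ∀ a, ∀ᶠ z in 𝓝 y, (e z).1 a = (e y).1 a := by
  obtain ⟨e, he⟩ := exists_homeomorph_yosida_ofSubmodule (X := Y) (S := constNear Y y)
    (Filter.Eventually.of_forall fun _ => rfl)
    (fun f hf g hg => by
      filter_upwards [show ∀ᶠ z in 𝓝 y, f z = f y from hf,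
        show ∀ᶠ z in 𝓝 y, g z = g y from hg] with z h1 h2
      simp [h1, h2])
    (fun f hf g hg => by
      filter_upwards [show ∀ᶠ z in 𝓝 y, f z = f y from hf,
        show ∀ᶠ z in 𝓝 y, g z = g y from hg] with z h1 h2
      simp [h1, h2])
    (fun s t hst => exists_eventually_const_separating y hst)
  refine ⟨_, e, fun (a : constNear Y y) => ?_⟩
  simp only [he]
  exact a.2

/-! ### The posets `V(C(K), μ(a(γ)))` -/

section Atom

variable {E : CompHaus.{u}} [ExtremallyDisconnected E] {p q : E} {hpq : p ≠ q}
  {hp : ¬ IsOpen ({p} : Set E)} {hq : ¬ IsOpen ({q} : Set E)}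
  {θ : ∀ X : CompHaus.{u}, Nonempty (glued E p q ≃ₜ X) → (glued E p q ≃ₜ X)}

theorem mem_V_of_homeomorph {Y : CompHaus.{u}} (hY : ¬ Nonempty (glued E p q ≃ₜ Y)) (A : WStar.{u})
    (e : Y ≃ₜ A.yosida) :
    (⟨A, A.yosidaMap (e : C(Y, A.yosida))⟩ : Over Y) ∈ V Y (atomOperator E p q hpq hp hq θ) := by
  refine ⟨Y, e, ?_⟩
  change (⟨(atomCover E p q θ Y).1, A.yosidaMap ((e : C(Y, A.yosida)).comp
    (atomCover E p q θ Y).2)⟩ : Σ Z : CompHaus.{u}, Hom A (cont Z)) = _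
  rw [show atomCover E p q θ Y = ⟨Y, ContinuousMap.id Y⟩ from dif_neg hY]
  rfl

/-- The chosen `θ` on the glued space need not be the identity; taking `η` to be its inverse
followed by `e` cancels it. -/
theorem mem_V_of_homeomorph_glued (A : WStar.{u}) (e : glued E p q ≃ₜ A.yosida) :
    (⟨A, A.yosidaMap ((e : C(glued E p q, A.yosida)).comp (gluing E p q))⟩ : Over E) ∈
      V E (atomOperator E p q hpq hp hq θ) := by
  have h : Nonempty (glued E p q ≃ₜ glued E p q) := ⟨Homeomorph.refl _⟩
  refine ⟨glued E p q, (θ _ h).symm.trans e, ?_⟩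
  change (⟨(atomCover E p q θ (glued E p q)).1, A.yosidaMap
    (((θ _ h).symm.trans e : C(glued E p q, A.yosida)).comp (atomCover E p q θ (glued E p q)).2)⟩ :
      Σ Z : CompHaus.{u}, Hom A (cont Z)) = _
  rw [show atomCover E p q θ (glued E p q) =
    ⟨E, (θ _ h : C(glued E p q, glued E p q)).comp (gluing E p q)⟩ from dif_pos h]
  congr 2
  ext z
  simp

/-- The two alternatives are the two cases in the definition of the atom. The second is an equality
of pairs because the type of `φ` depends on `K`, which is only propositionally equal to `E`. -/
theorem exists_homeomorph_of_mem_V {K : CompHaus.{u}} {A : WStar.{u}} {φ : Hom A (cont K)}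
    (h : (⟨A, φ⟩ : Over K) ∈ V K (atomOperator E p q hpq hp hq θ)) :
    (∃ e : K ≃ₜ A.yosida, φ = A.yosidaMap (e : C(K, A.yosida))) ∨
      ∃ (_ : K = E) (e : glued E p q ≃ₜ A.yosida),
        (⟨K, φ⟩ : Σ Z : CompHaus.{u}, Hom A (cont Z)) =
          ⟨E, A.yosidaMap ((e : C(glued E p q, A.yosida)).comp (gluing E p q))⟩ := by
  obtain ⟨X, η, hX⟩ := h
  change (⟨(atomCover E p q θ X).1, A.yosidaMap ((η : C(X, A.yosida)).comp
    (atomCover E p q θ X).2)⟩ : Σ Z : CompHaus.{u}, Hom A (cont Z)) = ⟨K, φ⟩ at hX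
  by_cases hne : Nonempty (glued E p q ≃ₜ X)
  · rw [show atomCover E p q θ X = ⟨E, (θ X hne : C(glued E p q, X)).comp (gluing E p q)⟩ from
      dif_pos hne] at hX
    exact Or.inr ⟨(congrArg Sigma.fst hX).symm, (θ X hne).trans η, hX.symm⟩
  · rw [show atomCover E p q θ X = ⟨X, ContinuousMap.id X⟩ from dif_neg hne] at hX
    obtain rfl : X = K := congrArg Sigma.fst hX
    exact Or.inl ⟨η, (eq_of_heq (Sigma.mk.inj hX).2).symm⟩

/-- A member has Yosida space `E` or the glued space, so the gluing map factors through it as `γ ∘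
id` or as `id ∘ γ`. -/
theorem isMinimum_finiteRange_glued : IsMinimum (atomOperator E p q hpq hp hq θ)
    ⟨finiteRange (glued E p q), finiteRangeMap (gluing E p q)⟩ := by
  have hzero := zeroDimensional_glued E p q
  have hcov := isCover_gluing E p q hpq hp hq
  refine ⟨?_, ?_⟩
  · obtain ⟨e, he⟩ := exists_finiteRangeMap_eq_yosidaMap hzero
    rw [he]
    exact mem_V_of_homeomorph_glued _ e
  · rintro ⟨A, φ⟩ hA
    rcases exists_homeomorph_of_mem_V hA with ⟨e, rfl⟩ | ⟨-, e, he⟩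
    · exact finiteRange_le hzero hcov (ContinuousMap.id E) Function.surjective_id (gluing E p q)
        rfl A e
    · obtain rfl := eq_of_heq (Sigma.mk.inj he).2
      exact finiteRange_le hzero hcov (gluing E p q) hcov.1 (ContinuousMap.id _) rfl A e

theorem exists_homeomorph_of_mem_V_of_ne {Y : CompHaus.{u}} (hY : ¬ Nonempty (Y ≃ₜ E))
    {A : WStar.{u}} {φ : Hom A (cont Y)}
    (h : (⟨A, φ⟩ : Over Y) ∈ V Y (atomOperator E p q hpq hp hq θ)) :
    ∃ e : Y ≃ₜ A.yosida, φ = A.yosidaMap (e : C(Y, A.yosida)) := by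
  rcases exists_homeomorph_of_mem_V h with h | ⟨rfl, -⟩
  · exact h
  · exact absurd ⟨Homeomorph.refl _⟩ hY

theorem isMinimum_finiteRange {Y : CompHaus.{u}} (hY : ¬ Nonempty (Y ≃ₜ glued E p q))
    (hYE : ¬ Nonempty (Y ≃ₜ E)) (hzero : ZeroDimensional Y) :
    IsMinimum (atomOperator E p q hpq hp hq θ)
      ⟨finiteRange Y, finiteRangeMap (ContinuousMap.id Y)⟩ := by
  refine ⟨?_, ?_⟩
  · obtain ⟨e, he⟩ := exists_finiteRangeMap_eq_yosidaMap hzero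
    rw [he]
    exact mem_V_of_homeomorph (fun ⟨h⟩ => hY ⟨h.symm⟩) _ e
  · rintro ⟨A, φ⟩ hA
    obtain ⟨e, rfl⟩ := exists_homeomorph_of_mem_V_of_ne hYE hA
    exact finiteRange_le hzero (isCover_id Y) (ContinuousMap.id Y) Function.surjective_id
      (ContinuousMap.id Y) rfl A e

/-- A minimum embeds, compatibly with the maps to `C(Y)`, in the functions constant near `y`, for
every `y`. Its elements are therefore locally constant on `Y`, and they separate points because `Y`
is its Yosida space. -/
theorem zeroDimensional_of_isMinimum {Y : CompHaus.{u}} (hY : ¬ Nonempty (Y ≃ₜ glued E p q))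
    (hYE : ¬ Nonempty (Y ≃ₜ E)) {P : Over Y} (hP : IsMinimum (atomOperator E p q hpq hp hq θ) P) :
    ZeroDimensional Y := by
  obtain ⟨A, φ⟩ := P
  obtain ⟨hmem, hmin⟩ := hP
  obtain ⟨e, rfl⟩ := exists_homeomorph_of_mem_V_of_ne hYE hmem
  have hconst : ∀ a y, ∀ᶠ z in 𝓝 y, (e z).1 a = (e y).1 a := by
    intro a y
    obtain ⟨B, e', he'⟩ := exists_homeomorph_constNear Y y
    obtain ⟨f, -, hf⟩ := hmin _ (mem_V_of_homeomorph (fun ⟨h⟩ => hY ⟨h.symm⟩) B e')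
    have hval : ∀ z, (e z).1 a = (e' z).1 (f a) := fun z =>
      congrArg (fun g : Hom A (cont Y) => (show (⊤ : Submodule ℝ C(Y, ℝ)) from g a).1 z) hf
    simp only [hval]
    exact he' _
  refine zeroDimensional_of_separating fun y z hyz => ?_
  obtain ⟨a, ha⟩ : ∃ a, (e y).1 a ≠ (e z).1 a := by
    by_contra hno
    push Not at hno
    exact hyz (e.injective (Subtype.ext (funext hno)))
  have hloc : IsLocallyConstant fun w => (e w).1 a :=
    (IsLocallyConstant.iff_eventually_eq _).2 (hconst a)
  exact ⟨_, hloc.isClopen_fiber ((e y).1 a), rfl, ha.symm⟩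

end Atom

end WStar

theorem mainTheorem9 (E : CompHaus.{u}) [Infinite E] [ExtremallyDisconnected E]
    (p q : E) (hpq : p ≠ q) (hp : ¬ IsOpen ({p} : Set E)) (hq : ¬ IsOpen ({q} : Set E))
    (θ : ∀ X : CompHaus.{u}, Nonempty (glued E p q ≃ₜ X) → (glued E p q ≃ₜ X)) :
    WStar.IsMinimum (atomOperator E p q hpq hp hq θ)
        ⟨WStar.finiteRange (glued E p q), WStar.finiteRangeMap (gluing E p q)⟩ ∧
      ∀ Y : CompHaus.{u}, ¬ Nonempty (Y ≃ₜ glued E p q) → ¬ Nonempty (Y ≃ₜ E) →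
        ((∃ P : WStar.Over Y, WStar.IsMinimum (atomOperator E p q hpq hp hq θ) P) ↔
            ZeroDimensional Y) ∧
          (ZeroDimensional Y → WStar.IsMinimum (atomOperator E p q hpq hp hq θ)
            ⟨WStar.finiteRange Y, WStar.finiteRangeMap (ContinuousMap.id Y)⟩) :=
  ⟨WStar.isMinimum_finiteRange_glued, fun _ hY hYE =>
    ⟨⟨fun ⟨_, hP⟩ => WStar.zeroDimensional_of_isMinimum hY hYE hP,
      fun h => ⟨_, WStar.isMinimum_finiteRange hY hYE h⟩⟩, WStar.isMinimum_finiteRange hY hYE⟩⟩
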